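/- Let $\mathbb K$ be an algebraically closed field of characteristic zero, and fix $i\in\mathbb K$ with $i^2=-1$. Let $n\ge 2$, let $R$ be a commutative local $\mathbb K$-algebra with unit, of dimension $n+2$ over $\mathbb K$, with maximal ideal $\mathfrak m$, and let $F$ be a symmetric bilinear form of rank $n+1$ on $R$ with $F(1,1)=0$. Assume that $W$ is a hyperplane in $\mathfrak m$ such that $$F(ab_1,b_2)+F(b_1,ab_2)=0\qquad\text{for all } a\in W,\ b_1,b_2\in R .$$ Then $R$ has a basis $e_0=1,e_1,\dots,e_n,e_{n+1}$ with $W=\langle e_1,\dots,e_n\rangle$, $\mathfrak m=\langle e_1,\dots,e_{n+1}\rangle$ and $e_{n+1}=e_1^2$, in which $$F(e_0,e_{n+1})=F(e_{n+1},e_0)=1,\qquad F(e_j,e_j)=-1\ \ (1\le j\le n-1),$$ and $F$ vanishes on all other pairs of basis vectors, and such that one of the following holds. 1. $n\ge 3$, and for some matrix $\Lambda=(\lambda_{jk})$ as described below there is an isomorphism $$R\cong\mathbb K[e_1,\dots,e_n]/\bigl(e_je_k-\lambda_{jk}e_n,\ e_j^2-e_k^2-(\lambda_{jj}-\lambda_{kk})e_n,\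 e_se_n\ ;\ 1\le j<k\le n-1,\ 1\le s\le n\bigr)$$ of $\mathbb K$-algebras under which the basis vectors $e_1,\dots,e_n$ correspond to the classes of the variables of the same name. Here $\Lambda$ is a symmetric block diagonal $(n-1)\times(n-1)$-matrix over $\mathbb K$, each of whose diagonal blocks has, for some size $s\ge 1$ and some $\lambda\in\mathbb K$, the form $$\lambda E+\tfrac12 A+\tfrac i2 B,$$ where $E$ is the identity $s\times s$-matrix, $A_{pq}=1$ if $|p-q|=1$ and $A_{pq}=0$ otherwise, and $B_{pq}=1$ if $p+q=s$, $B_{pq}=-1$ if $p+q=s+2$, and $B_{pq}=0$ otherwise ($1\le p,q\le s$). (This is the canonical form of a symmetric matrix under orthogonal transformations.) 2. $n=2$, and either $R\cong\mathbb K[e_1,e_2]/(e_1^3,e_1e_2,e_2^2)$, where the basis vectors $e_1,e_2$ correspond to the classes of the variables, or $R\cong\mathbb K[e_1]/(e_1^4)$, where the basis vector $e_1$ corresponds to the class of the variable and $e_2=e_1^3$, $e_3=e_1^2$. -/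

import Mathlib

namespace CorankOne

/-- The invariance condition `F (a b₁, b₂) + F (b₁, a b₂) = 0` for all `a ∈ W` and `b₁, b₂ ∈ R`. -/
def IsInvariant {K R : Type*} [Field K] [CommRing R] [Algebra K R]
    (W : Submodule K R) (F : LinearMap.BilinForm K R) : Prop :=
  ∀ a ∈ W, ∀ b₁ b₂ : R, F (a * b₁) b₂ + F b₁ (a * b₂) = 0

/-- The normal form of the matrix of `F`, with rows and columns numbered `0, …, n + 1`:
the entries at `(0, n + 1)` and `(n + 1, 0)` are `1`, the diagonal entries number `1, …, n - 1`
are `-1`, and all other entries are `0`. -/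
def normalMatrix (K : Type*) [Field K] (n : ℕ) : Matrix (Fin (n + 2)) (Fin (n + 2)) K :=
  Matrix.of fun i j =>
    if (i = 0 ∧ j = Fin.last (n + 1)) ∨ (i = Fin.last (n + 1) ∧ j = 0) then 1
    else if i = j ∧ 0 < (i : ℕ) ∧ (i : ℕ) < n then -1
    else 0

/-- The symmetric Jordan block of size `s` with parameter `c`, where `im` is a square root of `-1`.
Rows and columns are numbered from `0`: the second summand has ones next to the main diagonal; the
third has `1` on the antidiagonal just above the main one and `-1` on the one just below it. -/
def symmBlock {K : Type*} [Field K] (im : K) (s : ℕ) (c : K) : Matrix (Fin s) (Fin s) K :=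
  c • (1 : Matrix (Fin s) (Fin s) K)
    + (1 / 2 : K) • (Matrix.of fun a b : Fin s =>
        if (a : ℕ) + 1 = b ∨ (b : ℕ) + 1 = a then 1 else 0)
    + (im / 2) • (Matrix.of fun a b : Fin s =>
        if (a : ℕ) + b + 2 = s then 1 else if (a : ℕ) + b = s then -1 else 0)

/-- `L` is block diagonal, with consecutive diagonal blocks `symmBlock im (s k) (c k)` of
positive sizes `s 0, …, s (r - 1)`. -/
def IsCanonical {K : Type*} [Field K] (im : K) {m : ℕ} (L : Matrix (Fin m) (Fin m) K) : Prop :=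
  ∃ (r : ℕ) (s : Fin r → ℕ) (c : Fin r → K) (h : ∑ k, s k = m),
    (∀ k, 0 < s k) ∧
    L = Matrix.reindex (finSigmaFinEquiv.trans (finCongr h)) (finSigmaFinEquiv.trans (finCongr h))
      (Matrix.blockDiagonal' fun k => symmBlock im (s k) (c k))

/-- The ideal of `K[e₁, …, eₙ]` generated by `eᵢ eⱼ - L i j eₙ` and
`eᵢ² - eⱼ² - (L i i - L j j) eₙ` for `1 ≤ i < j ≤ n - 1`, and `eₛ eₙ` for `1 ≤ s ≤ n`.
Indices start at `0` in the code, so `eₙ` is the variable number `n - 1`. -/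
noncomputable def relIdeal {K : Type*} [Field K] {n : ℕ} (hn : 0 < n)
    (L : Matrix (Fin (n - 1)) (Fin (n - 1)) K) : Ideal (MvPolynomial (Fin n) K) :=
  let v : Fin (n - 1) → MvPolynomial (Fin n) K :=
    fun i => MvPolynomial.X (Fin.castLE (Nat.sub_le n 1) i)
  let z : MvPolynomial (Fin n) K := MvPolynomial.X ⟨n - 1, Nat.sub_lt hn Nat.one_pos⟩
  Ideal.span
    ({p | ∃ i j : Fin (n - 1), i < j ∧ p = v i * v j - MvPolynomial.C (L i j) * z}
      ∪ {p | ∃ i j : Fin (n - 1), i < j ∧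
          p = v i ^ 2 - v j ^ 2 - MvPolynomial.C (L i i - L j j) * z}
      ∪ {p | ∃ s : Fin n, p = MvPolynomial.X s * z})

end CorankOne

/-!
Elements of `W` are skew-adjoint for `F`, so products of two of them are self-adjoint. Choose `a` in
`W` with `F 1 (a ^ 2) = 1`. For `b` and `c` in `W`, the element `b * c - F 1 (b * c) • a ^ 2` is
self-adjoint and lies in `W`, where everything is skew-adjoint; hence it lies in the kernel of `F`,
which is a line spanned by some `z` in `W` and killed by the maximal ideal. The multiplication on
`W` is therefore described by two symmetric forms, `-F` and the one which reads off the coefficient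
of `z`. Jordan chains of the operator relating the two forms, rotated by `im` into orthonormal
vectors, bring the pair to canonical form. The presentations of `R` follow because the relations
already force `1`, `x₁, …, xₙ`, `x₁ ^ 2` to span the quotient of the polynomial ring.
-/

namespace CorankOne

open Module Polynomial

section SymmetricForms

variable {K V ι : Type*} [Field K] [AddCommGroup V] [Module K V] {b : LinearMap.BilinForm K V}

/-- The Gram matrix of a family of vectors with respect to a bilinear form; unlike for
`LinearMap.BilinForm.toMatrix`, the family need not be a basis. -/
def gramMatrix (b : LinearMap.BilinForm K V) (u : ι → V) : Matrix ι ι K :=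
  Matrix.of fun i j => b (u i) (u j)

theorem exists_apply_self_ne_zero [NeZero (2 : K)] (hs : b.IsSymm) (hb : b ≠ 0) :
    ∃ x, b x x ≠ 0 :=
  haveI := invertibleOfNonzero (two_ne_zero' K)
  LinearMap.BilinForm.exists_bilinForm_self_ne_zero hb (LinearMap.BilinForm.isSymm_iff.mp hs)

theorem two_mul_finrank_le_of_isotropic [FiniteDimensional K V] (hb : b.IsRefl)
    {P : Submodule K V} (hP : ∀ x ∈ P, ∀ y ∈ P, b x y = 0) :
    2 * finrank K P ≤ finrank K V + finrank K (LinearMap.ker b) := by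
  have hle : finrank K P ≤ finrank K (b.orthogonal P) :=
    Submodule.finrank_mono fun x hx y hy => hP y hy x hx
  have hadd := LinearMap.BilinForm.finrank_add_finrank_orthogonal hb P
  have hker : finrank K (P ⊓ b.orthogonal ⊤ : Submodule K V) ≤ finrank K (LinearMap.ker b) := by
    rw [LinearMap.BilinForm.orthogonal_top_eq_ker hb]
    exact Submodule.finrank_mono inf_le_right
  omega

theorem isSelfAdjoint_pow {T : End K V} (hT : b.IsSelfAdjoint T) (k : ℕ) :
    b.IsSelfAdjoint (T ^ k : End K V) := by
  induction k with
  | zero => exact LinearMap.isAdjointPair_one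
  | succ k ih =>
    have h : b.IsAdjointPair b (T ^ k * T : End K V) (T * T ^ k : End K V) := ih.mul hT
    rwa [← pow_succ, ← pow_succ'] at h

theorem isSelfAdjoint_aeval {T : End K V} (hT : b.IsSelfAdjoint T) (p : K[X]) :
    b.IsSelfAdjoint (aeval T p) := by
  rw [aeval_eq_sum_range]
  exact b.selfAdjointSubmodule.sum_mem fun k _ =>
    b.selfAdjointSubmodule.smul_mem _ (isSelfAdjoint_pow hT k)

/-- If `T` has minimal polynomial `(X - c) ^ (t + 1) * q`, then the form `b x (P y)`, where
`P = (T - c) ^ t * q(T)`, is symmetric and nonzero, and `q(T) x` works whenever `b x (P x) ≠ 0`. -/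
theorem exists_pow_apply_eq_zero_and_apply_ne_zero [NeZero (2 : K)] [FiniteDimensional K V]
    (hs : b.IsSymm) (hb : b.Nondegenerate) {T : End K V} (hT : b.IsSelfAdjoint T) {c : K}
    (hc : T.HasEigenvalue c) :
    ∃ (t : ℕ) (v : V), ((T - algebraMap K (End K V) c) ^ (t + 1)) v = 0 ∧
      b v (((T - algebraMap K (End K V) c) ^ t) v) ≠ 0 := by
  have hμ : minpoly K T ≠ 0 := minpoly.ne_zero (Algebra.IsIntegral.isIntegral T)
  obtain ⟨q, hq, hqc⟩ := exists_eq_pow_rootMultiplicity_mul_and_not_dvd (minpoly K T) hμ c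
  obtain ⟨t, ht⟩ := Nat.exists_eq_succ_of_ne_zero
    ((rootMultiplicity_pos hμ).mpr (End.hasEigenvalue_iff_isRoot.mp hc)).ne'
  rw [ht] at hq
  have hN (k : ℕ) : (T - algebraMap K (End K V) c) ^ k = aeval T ((X - C c) ^ k) := by simp
  set P := (X - C c) ^ t * q
  have hμP : minpoly K T = (X - C c) * P := by
    rw [hq, Nat.succ_eq_add_one, pow_succ', mul_assoc]
  have hTP : aeval T P ≠ 0 := fun h0 => by
    obtain ⟨r, hr⟩ := hμP ▸ minpoly.dvd K T h0
    refine not_isUnit_X_sub_C c (isUnit_of_dvd_one ⟨r, mul_left_cancel₀ (a := P) ?_ ?_⟩)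
    · exact fun hP => hμ (by rw [hμP, hP, mul_zero])
    · linear_combination hr
  have hsymm : LinearMap.BilinForm.IsSymm (b.compl₂ (aeval T P)) :=
    ⟨fun x y => (isSelfAdjoint_aeval hT P x y).symm.trans (hs.eq _ _)⟩
  obtain ⟨x, hx⟩ := exists_apply_self_ne_zero hsymm fun h0 => hTP <|
    LinearMap.ext fun y => hb.2 _ fun x => LinearMap.congr_fun₂ h0 x y
  obtain ⟨r, hr⟩ := X_sub_C_dvd_sub_C_eval (a := c) (p := q)
  have hqP : aeval T (q * P) = q.eval c • aeval T P := by
    rw [show q * P = C (q.eval c) * P + r * minpoly K T by rw [hμP]; linear_combination P * hr]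
    simp [Algebra.smul_def]
  refine ⟨t, aeval T q x, ?_, ?_⟩
  · rw [hN, ← End.mul_apply, ← map_mul, ← hq, minpoly.aeval, LinearMap.zero_apply]
  · rw [hN, isSelfAdjoint_aeval hT q, ← End.mul_apply, ← End.mul_apply, ← map_mul, ← map_mul,
      mul_assoc, hqP, LinearMap.smul_apply, map_smul]
    exact smul_ne_zero (fun h => hqc (dvd_iff_isRoot.mpr h)) hx

theorem apply_add_smul_pow {N : End K V} (hN : b.IsSelfAdjoint N) (v : V) (α : K)
    (j k : ℕ) :
    b (v + α • (N ^ j) v) ((N ^ k) (v + α • (N ^ j) v)) =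
      b v ((N ^ k) v) + 2 * α * b v ((N ^ (k + j)) v) + α ^ 2 * b v ((N ^ (k + j + j)) v) := by
  have hpow (l : ℕ) (y : V) : b ((N ^ j) v) ((N ^ l) y) = b v ((N ^ (l + j)) y) := by
    rw [isSelfAdjoint_pow hN, ← End.mul_apply, ← pow_add, add_comm]
  simp only [map_add, map_smul, LinearMap.add_apply, LinearMap.smul_apply, smul_eq_mul, hpow,
    ← End.mul_apply, ← pow_add]
  ring

theorem exists_forall_lt_apply_pow_eq_zero [NeZero (2 : K)] {N : End K V} (hN : b.IsSelfAdjoint N)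
    {t : ℕ} {v : V} (hv : (N ^ (t + 1)) v = 0) (hvt : b v ((N ^ t) v) ≠ 0) (j : ℕ) (hj : j ≤ t) :
    ∃ v : V, (N ^ (t + 1)) v = 0 ∧ b v ((N ^ t) v) ≠ 0 ∧
      ∀ k < t, t - j ≤ k → b v ((N ^ k) v) = 0 := by
  induction j with
  | zero => exact ⟨v, hv, hvt, fun k h₁ h₂ => by omega⟩
  | succ j ih =>
    obtain ⟨v, hv, hvt, h0⟩ := ih (by omega)
    have hz {k : ℕ} (hk : t < k) : (N ^ k) v = 0 := End.pow_map_zero_of_le hk hv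
    set α : K := -b v ((N ^ (t - (j + 1))) v) / (2 * b v ((N ^ t) v)) with hα
    refine ⟨v + α • (N ^ (j + 1)) v, ?_, ?_, fun k hk hjk => ?_⟩
    · rw [map_add, map_smul, ← End.mul_apply, ← pow_add, hv, hz (by omega), smul_zero, add_zero]
    · rw [apply_add_smul_pow hN, hz (by omega : t < t + (j + 1)),
        hz (by omega : t < t + (j + 1) + (j + 1))]
      simpa using hvt
    rw [apply_add_smul_pow hN, hz (by omega : t < k + (j + 1) + (j + 1))]
    rcases hjk.eq_or_lt with rfl | hlt
    · rw [Nat.sub_add_cancel hj, hα]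
      field_simp
      simp
    · rw [h0 k hk (by omega), hz (by omega : t < k + (j + 1))]
      simp

theorem exists_forall_apply_pow_eq_ite [IsAlgClosed K] [NeZero (2 : K)] {N : End K V}
    (hN : b.IsSelfAdjoint N) {t : ℕ} {v : V} (hv : (N ^ (t + 1)) v = 0)
    (hvt : b v ((N ^ t) v) ≠ 0) (κ : K) :
    ∃ v : V, (N ^ (t + 1)) v = 0 ∧ ∀ k, b v ((N ^ k) v) = if k = t then κ else 0 := by
  obtain ⟨v, hv, hvt, h0⟩ := exists_forall_lt_apply_pow_eq_zero hN hv hvt t le_rfl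
  obtain ⟨r, hr⟩ := IsAlgClosed.exists_pow_nat_eq (κ / b v ((N ^ t) v)) two_pos
  refine ⟨r • v, by rw [map_smul, hv, smul_zero], fun k => ?_⟩
  have hrk : b (r • v) ((N ^ k) (r • v)) = r ^ 2 * b v ((N ^ k) v) := by
    simp only [map_smul, LinearMap.smul_apply, smul_eq_mul]
    ring
  rw [hrk]
  split_ifs with hk
  · rw [hk, hr, div_mul_cancel₀ _ hvt]
  · rcases lt_or_gt_of_ne hk with hk | hk
    · rw [h0 k hk (by omega), mul_zero]
    · rw [End.pow_map_zero_of_le hk hv, map_zero, mul_zero]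

/-- If the Gram matrix of `x 0, …, x t` has entries `im / 2` on the antidiagonal and `0` elsewhere,
these combinations are orthonormal, where `im` is a square root of `-1`. -/
def symmetrizedChain (im : K) (t : ℕ) (x : ℕ → V) (p : Fin (t + 1)) : V :=
  x p - im • x (t - p)

theorem symmetrizedChain_add_smul_symmetrizedChain {im : K} (him : im ^ 2 = -1) {t k : ℕ}
    (hk : k ≤ t) (x : ℕ → V) :
    symmetrizedChain im t x ⟨k, by omega⟩ + im • symmetrizedChain im t x ⟨t - k, by omega⟩ =
      (2 : K) • x k := by
  simp only [symmetrizedChain, Nat.sub_sub_self hk, smul_sub, smul_smul, ← sq, him]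
  module

theorem apply_symmetrizedChain {im : K} (him : im ^ 2 = -1) (B : LinearMap.BilinForm K V) {t : ℕ}
    {x : ℕ → V} {h : ℕ → K} (hx : ∀ k l, B (x k) (x l) = h (k + l)) (p q : Fin (t + 1)) :
    B (symmetrizedChain im t x p) (symmetrizedChain im t x q) =
      h (p + q) - h (t - p + (t - q)) - im * (h (p + (t - q)) + h (t - p + q)) := by
  simp only [symmetrizedChain, map_sub, map_smul, LinearMap.sub_apply, LinearMap.smul_apply,
    smul_eq_mul, hx]
  linear_combination h (t - p + (t - q)) * him

theorem gramMatrix_symmetrizedChain_eq_one [NeZero (2 : K)] {im : K} (him : im ^ 2 = -1) {t : ℕ}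
    {x : ℕ → V} (hx : ∀ k l, b (x k) (x l) = if k + l = t then im / 2 else 0) :
    gramMatrix b (symmetrizedChain im t x) = 1 := by
  ext p q
  rw [gramMatrix, Matrix.of_apply, Matrix.one_apply,
    apply_symmetrizedChain him b (h := fun k => if k = t then im / 2 else 0) hx]
  have hrev : t - p + (t - q) = t ↔ (p : ℕ) + q = t := by omega
  have hpq : (p : ℕ) + (t - q) = t ↔ p = q := by omega
  have hqp : t - (p : ℕ) + q = t ↔ p = q := by omega
  simp only [hrev, hpq, hqp, ← mul_boole _ (im / 2)]
  linear_combination -(if p = q then 1 else 0) * (him + im ^ 2 * mul_inv_cancel₀ (two_ne_zero' K))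

theorem gramMatrix_symmetrizedChain_eq_symmBlock [NeZero (2 : K)] {im c : K} (him : im ^ 2 = -1)
    (g : LinearMap.BilinForm K V) {t : ℕ} {x : ℕ → V}
    (hx : ∀ k l, g (x k) (x l) =
      c * (if k + l = t then im / 2 else 0) + if k + l + 1 = t then im / 2 else 0) :
    gramMatrix g (symmetrizedChain im t x) = symmBlock im (t + 1) c := by
  ext p q
  rw [gramMatrix, Matrix.of_apply, apply_symmetrizedChain him g
    (h := fun k => c * (if k = t then im / 2 else 0) + if k + 1 = t then im / 2 else 0) hx]
  have hrev : t - p + (t - q) = t ↔ (p : ℕ) + q = t := by omega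
  have hpq : (p : ℕ) + (t - q) = t ↔ p = q := by omega
  have hqp : t - (p : ℕ) + q = t ↔ p = q := by omega
  have hrev' : t - p + (t - q) + 1 = t ↔ (p : ℕ) + q = t + 1 := by omega
  have hpq' : (p : ℕ) + (t - q) + 1 = t ↔ (p : ℕ) + 1 = q := by omega
  have hqp' : t - (p : ℕ) + q + 1 = t ↔ (q : ℕ) + 1 = p := by omega
  have hadj : (if (p : ℕ) + 1 = q ∨ (q : ℕ) + 1 = p then (1 : K) else 0) =
      (if (p : ℕ) + 1 = q then 1 else 0) + if (q : ℕ) + 1 = p then 1 else 0 := by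
    split_ifs <;> first | omega | simp
  have hanti : (if (p : ℕ) + q + 2 = t + 1 then (1 : K) else if (p : ℕ) + q = t + 1 then -1 else 0)
      = (if (p : ℕ) + q + 1 = t then 1 else 0) - if (p : ℕ) + q = t + 1 then 1 else 0 := by
    split_ifs <;> first | omega | simp
  simp only [symmBlock, Matrix.add_apply, Matrix.smul_apply, Matrix.one_apply, Matrix.of_apply,
    smul_eq_mul, hadj, hanti, hrev, hpq, hqp, hrev', hpq', hqp', ← mul_boole _ (im / 2)]
  linear_combination
    -c * (if p = q then 1 else 0) * (him + im ^ 2 * mul_inv_cancel₀ (two_ne_zero' K))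
    - ((if (p : ℕ) + 1 = q then 1 else 0) + if (q : ℕ) + 1 = p then 1 else 0) / 2 * him

theorem exists_gramMatrix_eq_symmBlock [IsAlgClosed K] [NeZero (2 : K)] [FiniteDimensional K V]
    [Nontrivial V] {im : K} (him : im ^ 2 = -1) {g : LinearMap.BilinForm K V}
    (hs : b.IsSymm) (hb : b.Nondegenerate) (hg : g.IsSymm) :
    ∃ (t : ℕ) (c : K) (u : Fin (t + 1) → V), gramMatrix b u = 1 ∧
      gramMatrix g u = symmBlock im (t + 1) c ∧
      ∀ y, (∀ p, b (u p) y = 0) → ∀ p, g (u p) y = 0 := by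
  let T : End K V := (b.toDual hb).symm.toLinearMap ∘ₗ g
  have hbT (x y : V) : b (T x) y = g x y :=
    LinearMap.BilinForm.apply_toDual_symm_apply (hB := hb) (g x) y
  have hT : b.IsSelfAdjoint T := fun x y => by
    rw [hbT, ← hs.eq, hbT, hg.eq]
  obtain ⟨c, hc⟩ := End.exists_eigenvalue T
  set N := T - algebraMap K (End K V) c with hN
  have hNadj : b.IsSelfAdjoint N := by
    have h := isSelfAdjoint_aeval hT (X - C c)
    rwa [map_sub, aeval_X, aeval_C] at h
  obtain ⟨t, v, hv, hvt⟩ := exists_pow_apply_eq_zero_and_apply_ne_zero hs hb hT hc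
  obtain ⟨v, hv, hvk⟩ := exists_forall_apply_pow_eq_ite hNadj hv hvt (im / 2)
  set x : ℕ → V := fun k => (N ^ k) v with hx
  have hgx (k : ℕ) (y : V) : g (x k) y = c * b (x k) y + b (x (k + 1)) y := by
    have hTx : T (x k) = c • x k + x (k + 1) := by
      simp [hx, pow_succ', hN]
    rw [← hbT, hTx, map_add, map_smul]; rfl
  have hbx (k l : ℕ) : b (x k) (x l) = if k + l = t then im / 2 else 0 := by
    rw [← hvk, hx, isSelfAdjoint_pow hNadj, ← End.mul_apply, ← pow_add]
  refine ⟨t, c, symmetrizedChain im t x, gramMatrix_symmetrizedChain_eq_one him hbx,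
    gramMatrix_symmetrizedChain_eq_symmBlock him g fun k l => ?_, fun y hy p => ?_⟩
  · rw [hgx, hbx, hbx, add_right_comm]
  have hbxy (k : ℕ) : b (x k) y = 0 := by
    rcases le_or_gt k t with hk | hk
    · have h2 := congrArg (b · y) (symmetrizedChain_add_smul_symmetrizedChain him hk x)
      simpa [hy, two_ne_zero' K] using h2.symm
    · simp [hx, End.pow_map_zero_of_le hk hv]
  simp [symmetrizedChain, hgx, hbxy]

theorem gramMatrix_append (B : LinearMap.BilinForm K V) {s m : ℕ} {u : Fin s → V} {w : Fin m → V}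
    (huw : ∀ p i, B (u p) (w i) = 0) (hwu : ∀ i p, B (w i) (u p) = 0) :
    gramMatrix B (Fin.append u w) =
      Matrix.reindex finSumFinEquiv finSumFinEquiv
        (Matrix.fromBlocks (gramMatrix B u) 0 0 (gramMatrix B w)) := by
  ext i j
  induction i using Fin.addCases <;> induction j using Fin.addCases <;> simp [gramMatrix, huw, hwu]

theorem isCanonical_of_isEmpty (im : K) (L : Matrix (Fin 0) (Fin 0) K) : IsCanonical im L :=
  ⟨0, Fin.elim0, Fin.elim0, rfl, fun k => k.elim0, Subsingleton.elim _ _⟩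

theorem reindex_blockDiagonal'_succ {r m : ℕ} (s : Fin (r + 1) → ℕ)
    (M : ∀ k, Matrix (Fin (s k)) (Fin (s k)) K) (h : ∑ k, s k = s 0 + m)
    (h' : ∑ k : Fin r, s k.succ = m) :
    Matrix.reindex (finSigmaFinEquiv.trans (finCongr h)) (finSigmaFinEquiv.trans (finCongr h))
        (Matrix.blockDiagonal' M) =
      Matrix.reindex finSumFinEquiv finSumFinEquiv (Matrix.fromBlocks (M 0) 0 0
        (Matrix.reindex (finSigmaFinEquiv.trans (finCongr h'))
          (finSigmaFinEquiv.trans (finCongr h')) (Matrix.blockDiagonal' fun k => M k.succ))) := by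
  subst h'
  set ε := finSigmaFinEquiv.trans (finCongr h)
  have hzero (p : Fin (s 0)) : ε ⟨0, p⟩ = Fin.castAdd _ p := by
    ext; simp [ε]
  have hsucc (k : Fin r) (p : Fin (s k.succ)) :
      ε ⟨k.succ, p⟩ = Fin.natAdd (s 0) (finSigmaFinEquiv ⟨k, p⟩) := by
    ext
    simp [ε, finSigmaFinEquiv_apply, Fin.sum_univ_succ, add_assoc]
  rw [← Equiv.eq_symm_apply]
  ext ⟨i, p⟩ ⟨j, q⟩
  rw [Matrix.reindex_symm, Matrix.reindex_apply, Matrix.submatrix_apply, Equiv.symm_symm]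
  induction i using Fin.cases <;> induction j using Fin.cases <;>
    simp [hzero, hsucc, Matrix.blockDiagonal'_apply', Fin.succ_ne_zero, Fin.succ_ne_zero _ |>.symm]

theorem IsCanonical.fromBlocks {im : K} {m s : ℕ} {L : Matrix (Fin m) (Fin m) K}
    (hL : IsCanonical im L) (hs : 0 < s) (c : K) :
    IsCanonical im (Matrix.reindex finSumFinEquiv finSumFinEquiv
      (Matrix.fromBlocks (symmBlock im s c) 0 0 L)) := by
  obtain ⟨r, t, d, hm, ht, rfl⟩ := hL
  let s' : Fin (r + 1) → ℕ := Fin.cons s t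
  let c' : Fin (r + 1) → K := Fin.cons c d
  have hsum : ∑ k, s' k = s + m := by simp [s', Fin.sum_univ_succ, hm]
  exact ⟨r + 1, s', c', hsum, Fin.cases hs ht,
    (reindex_blockDiagonal'_succ s' (fun k => symmBlock im (s' k) (c' k)) hsum hm).symm⟩

theorem linearIndependent_of_gramMatrix_eq_one [DecidableEq ι] {u : ι → V}
    (hu : gramMatrix b u = 1) : LinearIndependent K u := by
  have huu (i j : ι) : b (u i) (u j) = (1 : Matrix ι ι K) i j := congr_fun₂ hu i j
  refine LinearMap.BilinForm.linearIndependent_of_iIsOrtho (B := b) (fun i j hij => ?_) fun i => ?_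
  · exact (huu i j).trans (Matrix.one_apply_ne hij)
  · simp [huu]

theorem isCompl_orthogonal_span_range [FiniteDimensional K V] [Finite ι] [DecidableEq ι]
    {u : ι → V} (hs : b.IsSymm) (hu : gramMatrix b u = 1) :
    IsCompl (Submodule.span K (Set.range u)) (b.orthogonal (Submodule.span K (Set.range u))) := by
  have huu (i j : ι) : b (u i) (u j) = (1 : Matrix ι ι K) i j := congr_fun₂ hu i j
  cases nonempty_fintype ι
  refine (LinearMap.BilinForm.isCompl_orthogonal_iff_disjoint hs.isRefl).mpr ?_
  refine Submodule.disjoint_def.mpr fun x hx hort => ?_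
  obtain ⟨a, rfl⟩ := (Submodule.mem_span_range_iff_exists_fun K).mp hx
  refine Finset.sum_eq_zero fun i _ => ?_
  have hi := hort (u i) (Submodule.subset_span ⟨i, rfl⟩)
  simp_all [Matrix.one_apply]

theorem exists_gramMatrix_eq_one_and_isCanonical_of_nondegenerate [IsAlgClosed K] [NeZero (2 : K)]
    [FiniteDimensional K V] {im : K} (him : im ^ 2 = -1) {g : LinearMap.BilinForm K V}
    (hs : b.IsSymm) (hb : b.Nondegenerate) (hg : g.IsSymm) {m : ℕ} (hm : finrank K V = m) :
    ∃ w : Fin m → V, gramMatrix b w = 1 ∧ IsCanonical im (gramMatrix g w) := by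
  induction m using Nat.strong_induction_on generalizing V with
  | _ m ih =>
  rcases subsingleton_or_nontrivial V with hV | hV
  · obtain rfl : m = 0 := by rw [← hm, finrank_zero_of_subsingleton]
    exact ⟨Fin.elim0, Subsingleton.elim _ _, isCanonical_of_isEmpty im _⟩
  obtain ⟨t, c, u, hu, hgu, hinv⟩ := exists_gramMatrix_eq_symmBlock him hs hb hg
  set U := Submodule.span K (Set.range u)
  have hcompl : IsCompl U (b.orthogonal U) := isCompl_orthogonal_span_range hs hu
  have hperp : (b.restrict (b.orthogonal U)).Nondegenerate := by
    rw [LinearMap.BilinForm.restrict_nondegenerate_iff_isCompl_orthogonal hs.isRefl,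
      LinearMap.BilinForm.orthogonal_orthogonal hb hs.isRefl]
    exact hcompl.symm
  obtain rfl : m = t + 1 + finrank K (b.orthogonal U) := by
    rw [← hm, ← Submodule.finrank_add_eq_of_isCompl hcompl,
      finrank_span_eq_card (linearIndependent_of_gramMatrix_eq_one hu), Fintype.card_fin]
  obtain ⟨w, hw, hgw⟩ := ih (finrank K (b.orthogonal U)) (by omega)
    (g := g.restrict (b.orthogonal U)) ⟨fun x y => hs.eq x y⟩ hperp ⟨fun x y => hg.eq x y⟩ rfl
  have hbuw (p i) : b (u p) (w i) = 0 := (w i).2 _ (Submodule.subset_span ⟨p, rfl⟩)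
  have hguw (p i) : g (u p) (w i) = 0 := hinv _ (fun p => hbuw p i) p
  refine ⟨Fin.append u fun i => w i, ?_, ?_⟩
  · rw [gramMatrix_append b hbuw fun i p => (hs.eq _ _).trans (hbuw p i), hu]
    change Matrix.reindex _ _ (Matrix.fromBlocks 1 0 0 (gramMatrix (b.restrict _) w)) = 1
    rw [hw, Matrix.fromBlocks_one, Matrix.reindex_apply, Matrix.submatrix_one_equiv]
  · rw [gramMatrix_append g hguw fun i p => (hg.eq _ _).trans (hguw p i), hgu]
    exact hgw.fromBlocks t.succ_pos c

theorem exists_gramMatrix_eq_one_and_isCanonical [IsAlgClosed K] [NeZero (2 : K)]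
    [FiniteDimensional K V] {im : K} (him : im ^ 2 = -1) {g : LinearMap.BilinForm K V}
    (hs : b.IsSymm) (hg : g.IsSymm) :
    ∃ w : Fin (finrank K (LinearMap.range b)) → V,
      gramMatrix b w = 1 ∧ IsCanonical im (gramMatrix g w) := by
  obtain ⟨C, hC⟩ := (LinearMap.ker b).exists_isCompl
  have hb : (b.restrict C).Nondegenerate :=
    (LinearMap.BilinForm.isSymm_iff.mp hs).nondegenerate_restrict_of_isCompl_ker hC.symm
  have hrank : finrank K C = finrank K (LinearMap.range b) := by
    have := b.finrank_range_add_finrank_ker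
    have := Submodule.finrank_add_eq_of_isCompl hC
    omega
  obtain ⟨w, hw⟩ := exists_gramMatrix_eq_one_and_isCanonical_of_nondegenerate him
    (g := g.restrict C) ⟨fun x y => hs.eq x y⟩ hb ⟨fun x y => hg.eq x y⟩ hrank
  exact ⟨fun i => w i, hw⟩

end SymmetricForms

section LocalAlgebra

variable {K R : Type*} [Field K] [CommRing R] [IsLocalRing R] [Algebra K R]

theorem exists_sub_algebraMap_mem_maximalIdeal [IsAlgClosed K] [FiniteDimensional K R] (x : R) :
    ∃ t : K, x - algebraMap K R t ∈ IsLocalRing.maximalIdeal R := by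
  obtain ⟨t, ht⟩ := (IsAlgClosed.algebraMap_bijective_of_isIntegral
    (k := K) (K := IsLocalRing.ResidueField R)).2 (IsLocalRing.residue R x)
  refine ⟨t, ?_⟩
  rw [← IsLocalRing.residue_eq_zero_iff, map_sub, ← ht, sub_eq_zero]
  rfl

theorem disjoint_maximalIdeal_span_one :
    Disjoint ((IsLocalRing.maximalIdeal R).restrictScalars K) (K ∙ (1 : R)) :=
  (Submodule.disjoint_span_singleton' one_ne_zero).mpr
    (Ideal.one_notMem (IsLocalRing.maximalIdeal R))

theorem finrank_maximalIdeal_add_one [IsAlgClosed K] [FiniteDimensional K R] :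
    finrank K (IsLocalRing.maximalIdeal R) + 1 = finrank K R := by
  have hcompl : IsCompl ((IsLocalRing.maximalIdeal R).restrictScalars K) (K ∙ (1 : R)) := by
    refine ⟨disjoint_maximalIdeal_span_one, codisjoint_iff_le_sup.mpr fun x _ => ?_⟩
    obtain ⟨t, ht⟩ := exists_sub_algebraMap_mem_maximalIdeal (K := K) x
    exact Submodule.mem_sup.mpr ⟨_, ht, algebraMap K R t,
      Submodule.mem_span_singleton.mpr ⟨t, (Algebra.algebraMap_eq_smul_one t).symm⟩,
      sub_add_cancel _ _⟩
  rw [← Submodule.finrank_add_eq_of_isCompl hcompl, finrank_span_singleton one_ne_zero]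
  rfl

theorem smul_eq_zero_of_mul_eq_smul {x y : R} (hx : x ∈ IsLocalRing.maximalIdeal R) {t : K}
    (h : x * y = t • y) : t • y = 0 := by
  by_cases ht : t = 0
  · rw [ht, zero_smul]
  have hunit : IsUnit (algebraMap K R t - x) := by
    by_contra hn
    have hmem := add_mem ((IsLocalRing.mem_maximalIdeal _).mpr hn) hx
    rw [sub_add_cancel] at hmem
    exact (IsLocalRing.mem_maximalIdeal _).mp hmem ((IsUnit.mk0 t ht).map (algebraMap K R))
  have hy : y = 0 := hunit.mul_right_eq_zero.mp (by rw [sub_mul, h, Algebra.smul_def, sub_self])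
  rw [hy, smul_zero]

end LocalAlgebra

/-- The data of the classification: a symmetric form `F` of corank one on a local algebra of
dimension `n + 2` which is invariant with respect to the hyperplane `W` of the maximal ideal. -/
structure IsCorankOnePair {K R : Type*} [Field K] [CommRing R] [IsLocalRing R] [Algebra K R]
    (n : ℕ) (F : LinearMap.BilinForm K R) (W : Submodule K R) : Prop where
  two_le : 2 ≤ n
  finrank_eq : finrank K R = n + 2
  isSymm : F.IsSymm
  finrank_range : finrank K (LinearMap.range F) = n + 1
  apply_one_one : F 1 1 = 0
  le_maximalIdeal : W ≤ (IsLocalRing.maximalIdeal R).restrictScalars K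
  finrank_add_one : finrank K W + 1 = finrank K (IsLocalRing.maximalIdeal R)
  isInvariant : IsInvariant W F

namespace IsCorankOnePair

variable {K R : Type*} [Field K] [CommRing R] [IsLocalRing R] [Algebra K R] {n : ℕ}
  {F : LinearMap.BilinForm K R} {W : Submodule K R}

theorem finiteDimensional (h : IsCorankOnePair n F W) : FiniteDimensional K R :=
  Module.finite_of_finrank_pos (by rw [h.finrank_eq]; omega)

theorem apply_comm (h : IsCorankOnePair n F W) (x y : R) : F x y = F y x :=
  h.isSymm.eq x y

theorem apply_eq_zero_left (h : IsCorankOnePair n F W) {z : R} (hz : z ∈ LinearMap.ker F) (x : R) :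
    F x z = 0 := by
  rw [h.apply_comm, LinearMap.mem_ker.mp hz, LinearMap.zero_apply]

theorem apply_mul_left (h : IsCorankOnePair n F W) {a : R} (ha : a ∈ W) (x y : R) :
    F (a * x) y = -F x (a * y) :=
  eq_neg_of_add_eq_zero_left (h.isInvariant a ha x y)

theorem apply_eq_neg (h : IsCorankOnePair n F W) {a : R} (ha : a ∈ W) (x : R) :
    F a x = -F 1 (a * x) := by
  simpa only [mul_one] using h.apply_mul_left ha 1 x

theorem finrank_ker (h : IsCorankOnePair n F W) : finrank K (LinearMap.ker F) = 1 := by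
  have := h.finiteDimensional
  have hadd := F.finrank_range_add_finrank_ker
  rw [h.finrank_range, h.finrank_eq] at hadd
  omega

theorem exists_smul_eq_of_mem_ker (h : IsCorankOnePair n F W) {y z : R} (hy : y ∈ LinearMap.ker F)
    (hz : z ∈ LinearMap.ker F) (hz0 : z ≠ 0) : ∃ t : K, t • z = y := by
  obtain ⟨t, ht⟩ := (finrank_eq_one_iff_of_nonzero' (⟨z, hz⟩ : LinearMap.ker F)
    (Subtype.coe_ne_coe.mp hz0)).mp h.finrank_ker ⟨y, hy⟩
  exact ⟨t, congrArg Subtype.val ht⟩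

theorem exists_mem_ker_ne_zero (h : IsCorankOnePair n F W) : ∃ z ∈ LinearMap.ker F, z ≠ 0 :=
  Submodule.exists_mem_ne_zero_of_ne_bot fun hbot =>
    zero_ne_one (α := ℕ) (by rw [← h.finrank_ker, hbot, finrank_bot])

section NeZeroTwo

variable [NeZero (2 : K)]

theorem apply_one (h : IsCorankOnePair n F W) {a : R} (ha : a ∈ W) : F 1 a = 0 := by
  have hneg := h.apply_eq_neg ha 1
  rw [h.apply_comm, mul_one] at hneg
  have htwo : (2 : K) * F 1 a = 0 := by linear_combination hneg
  exact (mul_eq_zero.mp htwo).resolve_left two_ne_zero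

theorem apply_one_mul_mul (h : IsCorankOnePair n F W) {a b c : R} (ha : a ∈ W) (hb : b ∈ W)
    (hc : c ∈ W) : F 1 (a * b * c) = 0 := by
  have hmove := h.apply_mul_left hb a c
  rw [h.apply_eq_neg ha, h.apply_comm, h.apply_eq_neg hc, show c * (b * a) = a * b * c by ring,
    ← mul_assoc] at hmove
  have htwo : (2 : K) * F 1 (a * b * c) = 0 := by linear_combination -hmove
  exact (mul_eq_zero.mp htwo).resolve_left two_ne_zero

end NeZeroTwo

variable [IsAlgClosed K]

theorem finrank_maximalIdeal (h : IsCorankOnePair n F W) :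
    finrank K ((IsLocalRing.maximalIdeal R).restrictScalars K) = n + 1 := by
  have := h.finiteDimensional
  have hadd := finrank_maximalIdeal_add_one (K := K) (R := R)
  rw [h.finrank_eq] at hadd
  exact Nat.succ_injective hadd

theorem finrank_hyperplane (h : IsCorankOnePair n F W) : finrank K W = n :=
  Nat.succ_injective (h.finrank_add_one.trans h.finrank_maximalIdeal)

variable [NeZero (2 : K)]

theorem exists_apply_apply_ne_zero (h : IsCorankOnePair n F W) : ∃ x ∈ W, ∃ y ∈ W, F x y ≠ 0 := by
  have := h.finiteDimensional
  by_contra! hWW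
  have hdisj : Disjoint W (K ∙ (1 : R)) :=
    disjoint_maximalIdeal_span_one.mono_left h.le_maximalIdeal
  have hdim := Submodule.finrank_sup_add_finrank_inf_eq W (K ∙ (1 : R))
  rw [hdisj.eq_bot, finrank_bot, finrank_span_singleton one_ne_zero, h.finrank_hyperplane] at hdim
  have hle := two_mul_finrank_le_of_isotropic (P := W ⊔ (K ∙ (1 : R))) h.isSymm.isRefl
    fun x hx y hy => by
      obtain ⟨a, ha, _, hs, rfl⟩ := Submodule.mem_sup.mp hx
      obtain ⟨b, hb, _, ht, rfl⟩ := Submodule.mem_sup.mp hy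
      obtain ⟨s, rfl⟩ := Submodule.mem_span_singleton.mp hs
      obtain ⟨t, rfl⟩ := Submodule.mem_span_singleton.mp ht
      simp [hWW a ha b hb, h.apply_one hb, h.apply_comm a 1, h.apply_one ha, h.apply_one_one]
  rw [h.finrank_eq, h.finrank_ker] at hle
  have := h.two_le
  omega

theorem exists_apply_one_sq (h : IsCorankOnePair n F W) : ∃ a ∈ W, F 1 (a ^ 2) = 1 := by
  obtain ⟨x, hx, y, hy, hxy⟩ := h.exists_apply_apply_ne_zero
  obtain ⟨⟨a, ha⟩, haa⟩ := exists_apply_self_ne_zero (b := F.restrict W)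
    (h.isSymm.restrict W) fun h0 => hxy (LinearMap.congr_fun₂ h0 ⟨x, hx⟩ ⟨y, hy⟩)
  have hne : F 1 (a ^ 2) ≠ 0 := by
    rwa [LinearMap.BilinForm.restrict_apply, LinearMap.domRestrict_apply, h.apply_eq_neg ha,
      neg_ne_zero, ← sq] at haa
  obtain ⟨r, hr⟩ := IsAlgClosed.exists_pow_nat_eq (F 1 (a ^ 2))⁻¹ (n := 2) two_pos
  exact ⟨r • a, W.smul_mem r ha, by
    rw [_root_.smul_pow, map_smul, smul_eq_mul, hr, inv_mul_cancel₀ hne]⟩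

theorem mem_iff (h : IsCorankOnePair n F W) {x : R} :
    x ∈ W ↔ x ∈ IsLocalRing.maximalIdeal R ∧ F 1 x = 0 := by
  have := h.finiteDimensional
  obtain ⟨a, ha, ha1⟩ := h.exists_apply_one_sq
  have hlt : (IsLocalRing.maximalIdeal R).restrictScalars K ⊓ LinearMap.ker (F 1)
      < (IsLocalRing.maximalIdeal R).restrictScalars K :=
    inf_le_left.lt_of_not_ge fun hge => by
      have hker : a ^ 2 ∈ LinearMap.ker (F 1) :=
        (hge (Ideal.pow_mem_of_mem _ (h.le_maximalIdeal ha) 2 two_pos)).2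
      exact one_ne_zero (ha1.symm.trans (LinearMap.mem_ker.mp hker))
  have hfin := Submodule.finrank_lt_finrank_of_lt hlt
  rw [h.finrank_maximalIdeal] at hfin
  have hW : W = (IsLocalRing.maximalIdeal R).restrictScalars K ⊓ LinearMap.ker (F 1) :=
    Submodule.eq_of_le_of_finrank_le (fun y hy => ⟨h.le_maximalIdeal hy, h.apply_one hy⟩)
      (by rw [h.finrank_hyperplane]; omega)
  exact iff_of_eq (congrArg (x ∈ ·) hW)

theorem sub_smul_sq_mem (h : IsCorankOnePair n F W) {a : R} (ha : a ∈ W) (ha1 : F 1 (a ^ 2) = 1)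
    {x : R} (hx : x ∈ IsLocalRing.maximalIdeal R) : x - F 1 x • a ^ 2 ∈ W :=
  h.mem_iff.mpr ⟨sub_mem hx (((IsLocalRing.maximalIdeal R).restrictScalars K).smul_mem _
    (Ideal.pow_mem_of_mem _ (h.le_maximalIdeal ha) 2 two_pos)), by simp [ha1]⟩

theorem mul_mul_mem (h : IsCorankOnePair n F W) {a b c : R} (ha : a ∈ W) (hb : b ∈ W)
    (hc : c ∈ W) : a * b * c ∈ W :=
  h.mem_iff.mpr ⟨Ideal.mul_mem_left _ _ (h.le_maximalIdeal hc), h.apply_one_mul_mul ha hb hc⟩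

theorem mem_ker_of_forall_apply_eq_zero (h : IsCorankOnePair n F W) {x : R} (hx : x ∈ W)
    (hxW : ∀ w ∈ W, F x w = 0) : x ∈ LinearMap.ker F := by
  have := h.finiteDimensional
  obtain ⟨a, ha, ha1⟩ := h.exists_apply_one_sq
  refine LinearMap.mem_ker.mpr (LinearMap.ext fun y => ?_)
  obtain ⟨s, hs⟩ := exists_sub_algebraMap_mem_maximalIdeal (K := K) y
  obtain ⟨w, hw, t, rfl⟩ : ∃ w ∈ W, ∃ t : K, y = w + t • a ^ 2 + s • 1 :=
    ⟨_, h.sub_smul_sq_mem ha ha1 hs, _, by rw [Algebra.algebraMap_eq_smul_one]; abel⟩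
  have hx1 : F x 1 = 0 := by rw [h.apply_comm, h.apply_one hx]
  have hxa : F x (a ^ 2) = 0 := by
    rw [h.apply_eq_neg hx, sq, ← mul_assoc, h.apply_one_mul_mul hx ha ha, neg_zero]
  simp [hxW w hw, hx1, hxa]

theorem mul_sub_smul_sq_mem_ker (h : IsCorankOnePair n F W) {a b c : R} (ha : a ∈ W)
    (ha1 : F 1 (a ^ 2) = 1) (hb : b ∈ W) (hc : c ∈ W) :
    b * c - F 1 (b * c) • a ^ 2 ∈ LinearMap.ker F := by
  -- Products of two elements of `W` are self-adjoint and elements of `W` are skew-adjoint.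
  have hself {p q : R} (hp : p ∈ W) (hq : q ∈ W) (y : R) : F (p * q) y = F 1 (p * q * y) := by
    rw [h.apply_mul_left hp, h.apply_eq_neg hq, neg_neg, mul_left_comm, mul_assoc]
  have hw := h.sub_smul_sq_mem ha ha1 (Ideal.mul_mem_left _ b (h.le_maximalIdeal hc))
  refine LinearMap.mem_ker.mpr (LinearMap.ext fun y => ?_)
  have hskew := h.apply_eq_neg hw y
  have hadj : F (b * c - F 1 (b * c) • a ^ 2) y = F 1 ((b * c - F 1 (b * c) • a ^ 2) * y) := by
    simp only [sq, map_sub, map_smul, LinearMap.sub_apply, LinearMap.smul_apply, hself hb hc,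
      hself ha ha, sub_mul, smul_mul_assoc]
  have htwo : (2 : K) * F (b * c - F 1 (b * c) • a ^ 2) y = 0 := by
    linear_combination hadj + hskew
  exact (mul_eq_zero.mp htwo).resolve_left two_ne_zero

theorem mul_eq_zero_of_mem_ker (h : IsCorankOnePair n F W) {x z : R}
    (hx : x ∈ IsLocalRing.maximalIdeal R) (hz : z ∈ LinearMap.ker F) : x * z = 0 := by
  obtain ⟨a, ha, ha1⟩ := h.exists_apply_one_sq
  have hW {w : R} (hw : w ∈ W) : w * z = 0 := by
    by_cases hz0 : z = 0
    · rw [hz0, mul_zero]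
    have hwz : w * z ∈ LinearMap.ker F := LinearMap.mem_ker.mpr <| LinearMap.ext fun y => by
      rw [h.apply_mul_left hw, LinearMap.mem_ker.mp hz, LinearMap.zero_apply, neg_zero,
        LinearMap.zero_apply]
    obtain ⟨t, ht⟩ := h.exists_smul_eq_of_mem_ker hwz hz hz0
    rw [← ht, smul_eq_zero_of_mul_eq_smul (h.le_maximalIdeal hw) ht.symm]
  have hsub := hW (h.sub_smul_sq_mem ha ha1 hx)
  rwa [sub_mul, smul_mul_assoc, sq, mul_assoc, hW ha, mul_zero, smul_zero, sub_zero] at hsub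

theorem ker_le (h : IsCorankOnePair n F W) : LinearMap.ker F ≤ W := by
  intro z hz
  obtain ⟨a, ha, ha1⟩ := h.exists_apply_one_sq
  refine h.mem_iff.mpr ⟨(IsLocalRing.mem_maximalIdeal _).mpr fun hunit => ?_,
    h.apply_eq_zero_left hz 1⟩
  have ha0 : a = 0 :=
    hunit.mul_left_eq_zero.mp (h.mul_eq_zero_of_mem_ker (h.le_maximalIdeal ha) hz)
  simp [ha0] at ha1

theorem apply_one_pow_four (h : IsCorankOnePair n F W) {a : R} (ha : a ∈ W)
    (ha1 : F 1 (a ^ 2) = 1) : F 1 (a ^ 4) = 0 := by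
  have ha2 : a ^ 2 ∈ IsLocalRing.maximalIdeal R :=
    Ideal.pow_mem_of_mem _ (h.le_maximalIdeal ha) 2 two_pos
  have hker := h.mul_sub_smul_sq_mem_ker ha ha1 ha (h.mul_mul_mem ha ha ha)
  rw [show a * (a * a * a) = a ^ 4 by ring] at hker
  have heigen := h.mul_eq_zero_of_mem_ker ha2 hker
  rw [mul_sub, mul_smul_comm, sub_eq_zero, show a ^ 2 * a ^ 2 = a ^ 4 by ring] at heigen
  have hzero := congrArg (F 1) (smul_eq_zero_of_mul_eq_smul ha2 heigen)
  rwa [map_smul, map_zero, smul_eq_mul, mul_self_eq_zero] at hzero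

theorem cube_mem_ker (h : IsCorankOnePair n F W) {a : R} (ha : a ∈ W) (ha1 : F 1 (a ^ 2) = 1) :
    a ^ 3 ∈ LinearMap.ker F := by
  have ha3 : a ^ 3 ∈ W := by
    rw [pow_succ, sq]
    exact h.mul_mul_mem ha ha ha
  refine h.mem_ker_of_forall_apply_eq_zero ha3 fun w hw => ?_
  have hmul := h.mul_eq_zero_of_mem_ker
    (Ideal.pow_mem_of_mem _ (h.le_maximalIdeal ha) 2 two_pos)
    (h.mul_sub_smul_sq_mem_ker ha ha1 ha hw)
  rw [mul_sub, mul_smul_comm, ← pow_add, sub_eq_zero, ← mul_assoc, ← pow_succ] at hmul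
  rw [h.apply_eq_neg ha3, hmul, map_smul, h.apply_one_pow_four ha ha1, smul_zero, neg_zero]

theorem exists_mul_eq (h : IsCorankOnePair n F W) {z : R} (hz : z ∈ LinearMap.ker F)
    (hz0 : z ≠ 0) :
    ∃ (u : R) (g : Dual K R), ∀ x ∈ W, ∀ y ∈ W, x * y = F 1 (x * y) • u + g (x * y) • z := by
  obtain ⟨a, ha, ha1⟩ := h.exists_apply_one_sq
  obtain ⟨g, hg⟩ := Module.Projective.exists_dual_eq_one K hz0
  refine ⟨a ^ 2 - g (a ^ 2) • z, g, fun x hx y hy => ?_⟩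
  obtain ⟨t, ht⟩ := h.exists_smul_eq_of_mem_ker (h.mul_sub_smul_sq_mem_ker ha ha1 hx hy) hz hz0
  rw [eq_sub_iff_add_eq'] at ht
  have hgt : g (x * y) = F 1 (x * y) * g (a ^ 2) + t := by
    conv_lhs => rw [← ht]
    simp only [map_add, map_smul, smul_eq_mul, hg, mul_one]
  calc x * y = F 1 (x * y) • a ^ 2 + t • z := ht.symm
    _ = F 1 (x * y) • (a ^ 2 - g (a ^ 2) • z) + g (x * y) • z := by rw [hgt]; module

end IsCorankOnePair

section NormalMatrix

variable {n : ℕ}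

@[elab_as_elim]
theorem frame_cases {motive : Fin (n + 2) → Prop} (zero : motive 0)
    (middle : ∀ i : Fin n, motive i.castSucc.succ) (last : motive (Fin.last (n + 1)))
    (i : Fin (n + 2)) : motive i :=
  Fin.cases zero (Fin.lastCases last middle) i

variable (K : Type*) [Field K]

theorem normalMatrix_zero (j : Fin (n + 2)) :
    normalMatrix K n 0 j = if j = Fin.last (n + 1) then 1 else 0 := by
  simp [normalMatrix]

theorem normalMatrix_last (j : Fin (n + 2)) :
    normalMatrix K n (Fin.last (n + 1)) j = if j = 0 then 1 else 0 := by
  simp [normalMatrix]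

theorem normalMatrix_succ_castSucc (i : Fin n) (j : Fin (n + 2)) :
    normalMatrix K n i.castSucc.succ j
      = if i.castSucc.succ = j ∧ (i : ℕ) + 1 < n then -1 else 0 := by
  simp [normalMatrix]

end NormalMatrix

section Frame

variable {A : Type*} [Semiring A] {n : ℕ} [NeZero n]

/-- The family `1, x₁, …, xₙ, x₁²`, where `x₁` is `x 0`. The bases of the classification are of
this form. -/
def frame (x : Fin n → A) : Fin (n + 2) → A :=
  Fin.cons 1 (Fin.snoc x (x 0 ^ 2))

theorem frame_zero (x : Fin n → A) : frame x 0 = 1 := rfl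

theorem frame_succ_castSucc (x : Fin n → A) (i : Fin n) : frame x i.castSucc.succ = x i := by
  simp [frame]

theorem frame_last (x : Fin n → A) : frame x (Fin.last (n + 1)) = x 0 ^ 2 := by
  simp [frame, ← Fin.succ_last]

theorem frame_one (x : Fin n → A) : frame x 1 = x 0 := by
  rw [← frame_succ_castSucc x 0]
  congr 1

theorem map_frame {B : Type*} [Semiring B] (f : A →+* B) (x : Fin n → A) (i : Fin (n + 2)) :
    f (frame x i) = frame (fun j => f (x j)) i := by
  induction i using frame_cases with
  | zero => simp only [frame_zero, map_one]
  | middle i => simp only [frame_succ_castSucc]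
  | last => simp only [frame_last, map_pow]

end Frame

/-- The elements `e₁, …, eₙ` of a basis in the conclusion of the classification, with `n = m + 2`:
the first `m + 1` are orthonormal for `-F` and the last one generates the kernel of `F`. -/
structure IsNormalFamily {K R : Type*} [Field K] [CommRing R] [Algebra K R] {m : ℕ}
    (F : LinearMap.BilinForm K R) (W : Submodule K R) (x : Fin (m + 2) → R) : Prop where
  mem : ∀ i, x i ∈ W
  gramMatrix_eq : gramMatrix F (fun i : Fin (m + 1) => x i.castSucc) = -1
  last_mem_ker : x (Fin.last (m + 1)) ∈ LinearMap.ker F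
  last_ne_zero : x (Fin.last (m + 1)) ≠ 0

namespace IsNormalFamily

variable {K R : Type*} [Field K] [CommRing R] [IsLocalRing R] [Algebra K R] {m : ℕ}
  {F : LinearMap.BilinForm K R} {W : Submodule K R} {x : Fin (m + 2) → R}

theorem apply_apply (hx : IsNormalFamily F W x) (h : IsCorankOnePair (m + 2) F W)
    (i j : Fin (m + 2)) : F (x i) (x j) = if i = j ∧ (i : ℕ) < m + 1 then -1 else 0 := by
  induction i using Fin.lastCases with
  | last => simp [LinearMap.mem_ker.mp hx.last_mem_ker]
  | cast i =>
    induction j using Fin.lastCases with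
    | last => simp [h.apply_eq_zero_left hx.last_mem_ker]
    | cast j =>
      refine (congrFun₂ hx.gramMatrix_eq i j).trans ?_
      simp [Matrix.one_apply, Nat.le_of_lt_succ i.2, apply_ite]

theorem apply_one_sq (hx : IsNormalFamily F W x) (h : IsCorankOnePair (m + 2) F W) :
    F 1 (x 0 ^ 2) = 1 := by
  rw [sq, ← neg_eq_iff_eq_neg.mpr (h.apply_eq_neg (hx.mem 0) (x 0)), hx.apply_apply h]
  simp

variable [IsAlgClosed K] [NeZero (2 : K)]

theorem gramMatrix_frame (hx : IsNormalFamily F W x) (h : IsCorankOnePair (m + 2) F W) :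
    gramMatrix F (frame x) = normalMatrix K (m + 2) := by
  have hsq := hx.apply_one_sq h
  have hsq' : F (x 0 ^ 2) 1 = 1 := by rw [h.apply_comm, hsq]
  have hone (i) : F 1 (x i) = 0 := h.apply_one (hx.mem i)
  have hone' (i) : F (x i) 1 = 0 := by rw [h.apply_comm, hone]
  have hmix (i) : F (x i) (x 0 ^ 2) = 0 := by
    rw [h.apply_eq_neg (hx.mem i), sq, ← mul_assoc,
      h.apply_one_mul_mul (hx.mem i) (hx.mem 0) (hx.mem 0), neg_zero]
  have hmix' (i) : F (x 0 ^ 2) (x i) = 0 := by rw [h.apply_comm, hmix]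
  have hfour : F (x 0 ^ 2) (x 0 ^ 2) = 0 := by
    rw [sq, h.apply_mul_left (hx.mem 0), h.apply_eq_neg (hx.mem 0), ← sq, ← mul_assoc, ← sq,
      ← pow_add, h.apply_one_pow_four (hx.mem 0) hsq, neg_zero, neg_zero]
  ext i j
  rw [gramMatrix, Matrix.of_apply]
  induction i using frame_cases with
  | zero =>
    rw [normalMatrix_zero]
    induction j using frame_cases with
    | zero => simp [frame_zero, h.apply_one_one, Fin.last_pos.ne]
    | middle j => simp [frame_zero, frame_succ_castSucc, hone]
    | last => simp [frame_zero, frame_last, hsq]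
  | middle i =>
    rw [normalMatrix_succ_castSucc]
    induction j using frame_cases with
    | zero => simp [frame_zero, frame_succ_castSucc, hone']
    | middle j => simp [frame_succ_castSucc, hx.apply_apply h]
    | last => simp [frame_succ_castSucc, frame_last, hmix]
  | last =>
    rw [normalMatrix_last]
    induction j using frame_cases with
    | zero => simp [frame_zero, frame_last, hsq']
    | middle j => simp [frame_succ_castSucc, frame_last, hmix']
    | last => simp [frame_last, hfour]

theorem linearIndependent_frame (hx : IsNormalFamily F W x) (h : IsCorankOnePair (m + 2) F W) :
    LinearIndependent K (frame x) := by
  refine Fintype.linearIndependent_iff.mpr fun c hc => ?_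
  have hpair (i) : ∑ j, c j * normalMatrix K (m + 2) i j = 0 := by
    simpa [← hx.gramMatrix_frame h, gramMatrix] using congrArg (F (frame x i)) hc
  have hzero : c 0 = 0 := by simpa [normalMatrix_last] using hpair (Fin.last _)
  have hlast : c (Fin.last _) = 0 := by simpa [normalMatrix_zero] using hpair 0
  have hmiddle (i : Fin (m + 1)) : c i.castSucc.castSucc.succ = 0 := by
    simpa [normalMatrix_succ_castSucc, ite_and, Nat.le_of_lt_succ i.2] using
      hpair i.castSucc.castSucc.succ
  refine frame_cases hzero (Fin.lastCases ?_ hmiddle) hlast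
  rw [Fin.sum_univ_succ, Fin.sum_univ_castSucc, Fin.sum_univ_castSucc] at hc
  simp only [hzero, hmiddle, Fin.succ_last, hlast, zero_smul, Finset.sum_const_zero, zero_add,
    add_zero, frame_succ_castSucc] at hc
  exact (smul_eq_zero.mp hc).resolve_right hx.last_ne_zero

theorem eq_span (hx : IsNormalFamily F W x) (h : IsCorankOnePair (m + 2) F W) :
    W = Submodule.span K (Set.range x) := by
  have := h.finiteDimensional
  have hli : LinearIndependent K x := by
    convert (hx.linearIndependent_frame h).comp _
      ((Fin.succ_injective _).comp (Fin.castSucc_injective _)) using 1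
    exact funext fun i => (frame_succ_castSucc x i).symm
  refine (Submodule.eq_of_le_of_finrank_eq
    (Submodule.span_le.mpr (Set.range_subset_iff.mpr hx.mem)) ?_).symm
  rw [finrank_span_eq_card hli, h.finrank_hyperplane, Fintype.card_fin]

theorem maximalIdeal_eq_span (hx : IsNormalFamily F W x) (h : IsCorankOnePair (m + 2) F W) :
    (IsLocalRing.maximalIdeal R).restrictScalars K
      = Submodule.span K (Set.range fun i : Fin (m + 3) => frame x i.succ) := by
  have := h.finiteDimensional
  have hmem (i : Fin (m + 3)) :
      frame x i.succ ∈ (IsLocalRing.maximalIdeal R).restrictScalars K := by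
    induction i using Fin.lastCases with
    | last =>
      rw [Fin.succ_last, frame_last]
      exact Ideal.pow_mem_of_mem _ (h.le_maximalIdeal (hx.mem 0)) 2 two_pos
    | cast i =>
      rw [frame_succ_castSucc]
      exact h.le_maximalIdeal (hx.mem i)
  refine (Submodule.eq_of_le_of_finrank_eq
    (Submodule.span_le.mpr (Set.range_subset_iff.mpr hmem)) ?_).symm
  have hli := (hx.linearIndependent_frame h).comp _ (Fin.succ_injective _)
  rw [h.finrank_maximalIdeal]
  exact (finrank_span_eq_card hli).trans (Fintype.card_fin _)

theorem exists_basis (hx : IsNormalFamily F W x) (h : IsCorankOnePair (m + 2) F W) :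
    ∃ e : Basis (Fin (m + 2 + 2)) K R, ⇑e = frame x ∧ e 0 = 1 ∧
      W = Submodule.span K (Set.range fun i : Fin (m + 2) => e i.castSucc.succ) ∧
      (IsLocalRing.maximalIdeal R).restrictScalars K
        = Submodule.span K (Set.range fun i : Fin (m + 3) => e i.succ) ∧
      e (Fin.last (m + 3)) = e 1 ^ 2 ∧
      LinearMap.BilinForm.toMatrix e F = normalMatrix K (m + 2) := by
  let e := basisOfLinearIndependentOfCardEqFinrank (hx.linearIndependent_frame h)
    (by rw [Fintype.card_fin, h.finrank_eq])
  have he : ⇑e = frame x := coe_basisOfLinearIndependentOfCardEqFinrank _ _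
  refine ⟨e, he, ?_, ?_, ?_, ?_, ?_⟩
  · rw [he, frame_zero]
  · simp only [he, frame_succ_castSucc]
    exact hx.eq_span h
  · simp only [he]
    exact hx.maximalIdeal_eq_span h
  · rw [he, frame_last, frame_one]
  · rw [← hx.gramMatrix_frame h, ← he]
    ext i j
    exact LinearMap.BilinForm.toMatrix_apply e F i j

end IsNormalFamily

/-- The relations of `relIdeal` for a family `x` in an algebra, with `n = m + 2`. -/
structure SatisfiesRelations {K A : Type*} [Field K] [CommRing A] [Algebra K A] {m : ℕ}
    (L : Matrix (Fin (m + 1)) (Fin (m + 1)) K) (x : Fin (m + 2) → A) : Prop where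
  mul_eq : ∀ i j : Fin (m + 1), i < j →
    x i.castSucc * x j.castSucc = L i j • x (Fin.last (m + 1))
  sq_sub_sq_eq : ∀ i j : Fin (m + 1), i < j →
    x i.castSucc ^ 2 - x j.castSucc ^ 2 = (L i i - L j j) • x (Fin.last (m + 1))
  mul_last : ∀ s, x s * x (Fin.last (m + 1)) = 0

namespace IsCorankOnePair

variable {K R : Type*} [Field K] [IsAlgClosed K] [NeZero (2 : K)] [CommRing R] [IsLocalRing R]
  [Algebra K R] {F : LinearMap.BilinForm K R} {W : Submodule K R}

theorem isNormalFamily_pair {n : ℕ} (h : IsCorankOnePair n F W) {a z : R} (ha : a ∈ W)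
    (ha1 : F 1 (a ^ 2) = 1) (hz : z ∈ LinearMap.ker F) (hz0 : z ≠ 0) :
    IsNormalFamily F W ![a, z] where
  mem := Fin.forall_fin_two.mpr ⟨ha, h.ker_le hz⟩
  gramMatrix_eq := by
    ext i j
    rw [Fin.fin_one_eq_zero i, Fin.fin_one_eq_zero j]
    simp [gramMatrix, h.apply_eq_neg ha, ← sq, ha1]
  last_mem_ker := hz
  last_ne_zero := hz0

theorem finrank_range_neg_restrict {n : ℕ} (h : IsCorankOnePair n F W) :
    finrank K (LinearMap.range (-F.restrict W)) + 1 = n := by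
  have := h.finiteDimensional
  have hker : LinearMap.ker (-F.restrict W) = (LinearMap.ker F).comap W.subtype := by
    ext ⟨x, hx⟩
    rw [LinearMap.ker_neg]
    exact ⟨fun h0 => h.mem_ker_of_forall_apply_eq_zero hx fun w hw =>
        LinearMap.congr_fun (LinearMap.mem_ker.mp h0) ⟨w, hw⟩,
      fun h0 => LinearMap.mem_ker.mpr <| LinearMap.ext fun w =>
        LinearMap.congr_fun (LinearMap.mem_ker.mp h0) w⟩
  have hadd := (-F.restrict W).finrank_range_add_finrank_ker
  rwa [hker, (Submodule.comapSubtypeEquivOfLe h.ker_le).finrank_eq, h.finrank_ker,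
    h.finrank_hyperplane] at hadd

theorem exists_gramMatrix_eq_neg_one_and_isCanonical {m : ℕ} (h : IsCorankOnePair (m + 2) F W)
    {im : K} (him : im ^ 2 = -1) (g : Dual K R) :
    ∃ w : Fin (m + 1) → R, (∀ i, w i ∈ W) ∧ gramMatrix F w = -1 ∧
      IsCanonical im (gramMatrix ((LinearMap.mul K R).compr₂ g) w) := by
  have := h.finiteDimensional
  have hpart := exists_gramMatrix_eq_one_and_isCanonical him (b := -F.restrict W)
    (g := LinearMap.BilinForm.restrict ((LinearMap.mul K R).compr₂ g) W)
    (h.isSymm.restrict W).neg ⟨fun x y => congrArg g (mul_comm (x : R) y)⟩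
  rw [Nat.succ_injective h.finrank_range_neg_restrict] at hpart
  obtain ⟨w, hw, hcan⟩ := hpart
  exact ⟨fun i => w i, fun i => (w i).2, neg_eq_iff_eq_neg.mp hw, hcan⟩

theorem exists_isNormalFamily_satisfiesRelations {m : ℕ} (h : IsCorankOnePair (m + 2) F W)
    {im : K} (him : im ^ 2 = -1) :
    ∃ (x : Fin (m + 2) → R) (L : Matrix (Fin (m + 1)) (Fin (m + 1)) K),
      IsNormalFamily F W x ∧ IsCanonical im L ∧ SatisfiesRelations L x := by
  obtain ⟨z, hz, hz0⟩ := h.exists_mem_ker_ne_zero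
  obtain ⟨u, g, hug⟩ := h.exists_mul_eq hz hz0
  obtain ⟨w, hw, hgram, hcan⟩ := h.exists_gramMatrix_eq_neg_one_and_isCanonical him g
  set L := gramMatrix ((LinearMap.mul K R).compr₂ g) w
  have hmul (i j) : w i * w j = (if i = j then u else 0) + L i j • z := by
    have hF : F (w i) (w j) = (-1 : Matrix (Fin (m + 1)) (Fin (m + 1)) K) i j :=
      congrFun₂ hgram i j
    have hone : F 1 (w i * w j) = if i = j then 1 else 0 := by
      rw [← neg_inj, ← h.apply_eq_neg (hw i), hF, Matrix.neg_apply, Matrix.one_apply]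
    refine (hug _ (hw i) _ (hw j)).trans ?_
    rw [hone, ite_smul, one_smul, zero_smul]
    rfl
  have hmem : ∀ i, Fin.snoc (α := fun _ => R) w z i ∈ W :=
    Fin.lastCases (by simpa using h.ker_le hz) fun i => by simpa using hw i
  refine ⟨Fin.snoc w z, L, ⟨hmem, ?_, ?_, ?_⟩, hcan, ?_, ?_, ?_⟩
  · simpa using hgram
  · simpa using hz
  · simpa using hz0
  · intro i j hij
    simp [hmul, hij.ne]
  · intro i j _
    simp [sq, hmul, sub_smul]
  · intro s
    simpa using h.mul_eq_zero_of_mem_ker (h.le_maximalIdeal (hmem s)) hz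

end IsCorankOnePair

section Presentation

variable {K : Type*} [Field K]

theorem span_range_frame_eq_top {Q : Type*} [CommRing Q] [Algebra K Q] {n : ℕ} [NeZero n]
    {y : Fin n → Q} (hy : Algebra.adjoin K (Set.range y) = ⊤)
    (hmul : ∀ i j, y i * y j ∈ Submodule.span K (Set.range (frame y)))
    (hsq : ∀ i, y i * y 0 ^ 2 ∈ Submodule.span K (Set.range (frame y))) :
    Submodule.span K (Set.range (frame y)) = ⊤ := by
  set S := Submodule.span K (Set.range (frame y))
  have hframe (i) : frame y i ∈ S := Submodule.subset_span ⟨i, rfl⟩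
  have hgen (i) : S ≤ S.comap (LinearMap.mulLeft K (y i)) := by
    refine Submodule.span_le.mpr (Set.range_subset_iff.mpr fun j => ?_)
    rw [SetLike.mem_coe, Submodule.mem_comap, LinearMap.mulLeft_apply]
    induction j using frame_cases with
    | zero =>
      rw [frame_zero, mul_one, ← frame_succ_castSucc y i]
      exact hframe _
    | middle j =>
      rw [frame_succ_castSucc]
      exact hmul i j
    | last =>
      rw [frame_last]
      exact hsq i
  have hstable (q : Q) : ∀ s ∈ S, q * s ∈ S := by
    induction hy ▸ Algebra.mem_top (R := K) (x := q) using Algebra.adjoin_induction with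
    | mem q hq =>
      obtain ⟨i, rfl⟩ := hq
      exact fun s hs => hgen i hs
    | algebraMap c =>
      intro s hs
      rw [← Algebra.smul_def]
      exact S.smul_mem c hs
    | add p q _ _ hp hq =>
      intro s hs
      rw [add_mul]
      exact S.add_mem (hp s hs) (hq s hs)
    | mul p q _ _ hp hq =>
      intro s hs
      rw [mul_assoc]
      exact hp _ (hq s hs)
  exact Submodule.eq_top_iff'.mpr fun q => mul_one q ▸ hstable q 1 (hframe 0)

theorem bijective_of_frame {Q R : Type*} [CommRing Q] [Algebra K Q] [CommRing R] [Algebra K R]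
    {n : ℕ} [NeZero n] {x : Fin n → R} {y : Fin n → Q} {φ : Q →ₐ[K] R} (hφ : ∀ i, φ (y i) = x i)
    (hy : Submodule.span K (Set.range (frame y)) = ⊤) {e : Basis (Fin (n + 2)) K R}
    (he : ⇑e = frame x) : Function.Bijective φ := by
  have hcomp : φ.toLinearMap ∘ frame y = e := by
    rw [he, ← funext hφ]
    exact funext (map_frame (φ : Q →+* R) y)
  exact LinearMap.bijective_of_linearIndependent_of_span_eq_top (f := φ.toLinearMap) hy
    (hcomp ▸ e.linearIndependent) (hcomp ▸ e.span_eq)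

/-- The classes of the variables in a quotient of a polynomial ring. -/
noncomputable abbrev mkX {σ : Type*} (I : Ideal (MvPolynomial σ K)) (i : σ) :
    MvPolynomial σ K ⧸ I :=
  Ideal.Quotient.mk I (MvPolynomial.X i)

theorem adjoin_range_mkX_eq_top {σ : Type*} (I : Ideal (MvPolynomial σ K)) :
    Algebra.adjoin K (Set.range (mkX I)) = ⊤ := by
  have hrange : Set.range (mkX I) = Ideal.Quotient.mkₐ K I '' Set.range MvPolynomial.X := by
    rw [← Set.range_comp]
    rfl
  rw [hrange, ← AlgHom.map_adjoin, MvPolynomial.adjoin_range_X, Algebra.map_top,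
    AlgHom.range_eq_top]
  exact Ideal.Quotient.mkₐ_surjective K I

theorem aeval_mkX {σ : Type*} (I : Ideal (MvPolynomial σ K)) (p : MvPolynomial σ K) :
    MvPolynomial.aeval (mkX I) p = Ideal.Quotient.mk I p :=
  (DFunLike.congr_fun (MvPolynomial.aeval_unique (Ideal.Quotient.mkₐ K I)) p).symm

theorem exists_algEquiv_mvPolynomial_quotient {R : Type*} [CommRing R] [Algebra K R] {n : ℕ}
    [NeZero n] {I : Ideal (MvPolynomial (Fin n) K)} {x : Fin n → R}
    (hI : I ≤ RingHom.ker (MvPolynomial.aeval (R := K) x))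
    (hmul : ∀ i j, mkX I i * mkX I j ∈ Submodule.span K (Set.range (frame (mkX I))))
    (hsq : ∀ i, mkX I i * mkX I 0 ^ 2 ∈ Submodule.span K (Set.range (frame (mkX I))))
    {e : Basis (Fin (n + 2)) K R} (he : ⇑e = frame x) :
    ∃ φ : (MvPolynomial (Fin n) K ⧸ I) ≃ₐ[K] R, ∀ i, φ (mkX I i) = x i := by
  let φ : (MvPolynomial (Fin n) K ⧸ I) →ₐ[K] R :=
    Ideal.Quotient.liftₐ I (MvPolynomial.aeval x) hI
  have hφ (i) : φ (mkX I i) = x i := MvPolynomial.aeval_X x i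
  have hspan := span_range_frame_eq_top (adjoin_range_mkX_eq_top I) hmul hsq
  exact ⟨AlgEquiv.ofBijective φ (bijective_of_frame hφ hspan he), hφ⟩

theorem relIdeal_le_ker_aeval_iff {A : Type*} [CommRing A] [Algebra K A] {m : ℕ}
    {L : Matrix (Fin (m + 1)) (Fin (m + 1)) K} {x : Fin (m + 2) → A} :
    relIdeal (Nat.succ_pos (m + 1)) L ≤ RingHom.ker (MvPolynomial.aeval (R := K) x)
      ↔ SatisfiesRelations L x := by
  have heval_mul (i j : Fin (m + 1)) : MvPolynomial.aeval x (MvPolynomial.X i.castSucc *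
      MvPolynomial.X j.castSucc - MvPolynomial.C (L i j) * MvPolynomial.X (Fin.last (m + 1))) =
      x i.castSucc * x j.castSucc - L i j • x (Fin.last (m + 1)) := by
    simp [Algebra.smul_def]
  have heval_sq (i j : Fin (m + 1)) : MvPolynomial.aeval x (MvPolynomial.X i.castSucc ^ 2 -
      MvPolynomial.X j.castSucc ^ 2 -
        MvPolynomial.C (L i i - L j j) * MvPolynomial.X (Fin.last (m + 1))) =
      x i.castSucc ^ 2 - x j.castSucc ^ 2 - (L i i - L j j) • x (Fin.last (m + 1)) := by
    simp [Algebra.smul_def]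
  have heval_last (s) : MvPolynomial.aeval (R := K) x (MvPolynomial.X s *
      MvPolynomial.X (Fin.last (m + 1))) = x s * x (Fin.last (m + 1)) := by
    simp
  rw [relIdeal, Ideal.span_le, Set.union_subset_iff, Set.union_subset_iff]
  constructor
  · rintro ⟨⟨hmul, hsq⟩, hlast⟩
    exact ⟨fun i j hij => sub_eq_zero.mp ((heval_mul i j).symm.trans (hmul ⟨i, j, hij, rfl⟩)),
      fun i j hij => sub_eq_zero.mp ((heval_sq i j).symm.trans (hsq ⟨i, j, hij, rfl⟩)),
      fun s => (heval_last s).symm.trans (hlast ⟨s, rfl⟩)⟩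
  · rintro ⟨hmul, hsq, hlast⟩
    refine ⟨⟨?_, ?_⟩, ?_⟩
    · rintro _ ⟨i, j, hij, rfl⟩
      exact (heval_mul i j).trans (sub_eq_zero.mpr (hmul i j hij))
    · rintro _ ⟨i, j, hij, rfl⟩
      exact (heval_sq i j).trans (sub_eq_zero.mpr (hsq i j hij))
    · rintro _ ⟨s, rfl⟩
      exact (heval_last s).trans (hlast s)

namespace SatisfiesRelations

variable {A : Type*} [CommRing A] [Algebra K A] {m : ℕ}
  {L : Matrix (Fin (m + 1)) (Fin (m + 1)) K} {x : Fin (m + 2) → A}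

theorem sq_eq (h : SatisfiesRelations L x) (i : Fin (m + 1)) :
    x i.castSucc ^ 2 = x 0 ^ 2 - (L 0 0 - L i i) • x (Fin.last (m + 1)) := by
  rcases (Fin.zero_le i).eq_or_lt with rfl | hi
  · simp
  · rw [← h.sq_sub_sq_eq 0 i hi, Fin.castSucc_zero]
    ring

theorem mul_mem_span (h : SatisfiesRelations L x) (i j : Fin (m + 2)) :
    x i * x j ∈ Submodule.span K (Set.range (frame x)) := by
  have hframe (i) : frame x i ∈ Submodule.span K (Set.range (frame x)) :=
    Submodule.subset_span ⟨i, rfl⟩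
  have hx (i) : x i ∈ Submodule.span K (Set.range (frame x)) :=
    frame_succ_castSucc x i ▸ hframe _
  induction j using Fin.lastCases with
  | last => simp [h.mul_last]
  | cast j =>
    induction i using Fin.lastCases with
    | last => simp [mul_comm, h.mul_last]
    | cast i =>
      rcases lt_trichotomy i j with hij | rfl | hij
      · rw [h.mul_eq i j hij]
        exact Submodule.smul_mem _ _ (hx _)
      · rw [← sq, h.sq_eq, ← frame_last]
        exact sub_mem (hframe _) (Submodule.smul_mem _ _ (hx _))
      · rw [mul_comm, h.mul_eq j i hij]
        exact Submodule.smul_mem _ _ (hx _)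

theorem mul_sq_eq_zero (h : SatisfiesRelations L x) (hm : 0 < m) (i : Fin (m + 2)) :
    x i * x 0 ^ 2 = 0 := by
  have hzero {i j : Fin (m + 1)} (hij : i < j) (s) : x s * (x i.castSucc * x j.castSucc) = 0 := by
    rw [h.mul_eq i j hij, mul_smul_comm, h.mul_last, smul_zero]
  induction i using Fin.lastCases with
  | last => rw [sq, mul_left_comm, mul_comm _ (x 0), h.mul_last, mul_zero]
  | cast i =>
    rcases (Fin.zero_le i).eq_or_lt with rfl | hi
    · have hlt : (0 : Fin (m + 1)) < ⟨1, by omega⟩ := Fin.lt_def.mpr one_pos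
      have hsq := congrArg (x 0 * ·) (h.sq_eq ⟨1, by omega⟩)
      have hmix := hzero hlt (Fin.castSucc ⟨1, by omega⟩)
      simp only [mul_sub, mul_smul_comm, h.mul_last, smul_zero, sub_zero] at hsq
      rw [Fin.castSucc_zero] at hmix ⊢
      rw [← hsq, sq, mul_left_comm, hmix]
    · rw [sq, mul_left_comm, mul_comm _ (x 0)]
      exact hzero hi 0

theorem exists_algEquiv {R : Type*} [CommRing R] [Algebra K R] {x : Fin (m + 2) → R}
    (h : SatisfiesRelations L x) (hm : 0 < m) {e : Basis (Fin (m + 2 + 2)) K R}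
    (he : ⇑e = frame x) :
    ∃ φ : (MvPolynomial (Fin (m + 2)) K ⧸ relIdeal (Nat.succ_pos (m + 1)) L) ≃ₐ[K] R,
      ∀ i, φ (mkX _ i) = x i := by
  have hy : SatisfiesRelations L (mkX (relIdeal (Nat.succ_pos (m + 1)) L)) :=
    relIdeal_le_ker_aeval_iff.mp fun p hp => by
      rw [RingHom.mem_ker, aeval_mkX]
      exact Ideal.Quotient.eq_zero_iff_mem.mpr hp
  refine exists_algEquiv_mvPolynomial_quotient (relIdeal_le_ker_aeval_iff.mpr h)
    hy.mul_mem_span (fun i => ?_) he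
  rw [hy.mul_sq_eq_zero hm]
  exact zero_mem _

end SatisfiesRelations

variable {R : Type*} [CommRing R] [Algebra K R] {a z : R} {e : Basis (Fin 4) K R}

theorem exists_algEquiv_quotient_span_cube_mul_sq (he : ⇑e = frame ![a, z]) (ha : a ^ 3 = 0)
    (haz : a * z = 0) (hz : z ^ 2 = 0) :
    ∃ φ : (MvPolynomial (Fin 2) K ⧸
        (Ideal.span {MvPolynomial.X 0 ^ 3, MvPolynomial.X 0 * MvPolynomial.X 1,
          MvPolynomial.X 1 ^ 2} : Ideal (MvPolynomial (Fin 2) K))) ≃ₐ[K] R,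
      φ (mkX _ 0) = a ∧ φ (mkX _ 1) = z := by
  set I : Ideal (MvPolynomial (Fin 2) K) := Ideal.span {MvPolynomial.X 0 ^ 3,
    MvPolynomial.X 0 * MvPolynomial.X 1, MvPolynomial.X 1 ^ 2}
  set S := Submodule.span K (Set.range (frame (mkX I)))
  have hker : I ≤ RingHom.ker (MvPolynomial.aeval (R := K) ![a, z]) := by
    refine Ideal.span_le.mpr ?_
    rintro p (rfl | rfl | rfl) <;> simp [RingHom.mem_ker, ha, haz, hz]
  have hcube : mkX I 0 ^ 3 = 0 :=
    Ideal.Quotient.eq_zero_iff_mem.mpr (Ideal.subset_span (by simp))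
  have hzero_one : mkX I 0 * mkX I 1 = 0 :=
    Ideal.Quotient.eq_zero_iff_mem.mpr (Ideal.subset_span (by simp))
  have hone_sq : mkX I 1 ^ 2 = 0 :=
    Ideal.Quotient.eq_zero_iff_mem.mpr (Ideal.subset_span (by simp))
  have hzero_sq : mkX I 0 ^ 2 ∈ S := Submodule.subset_span ⟨Fin.last 3, frame_last _⟩
  have hmul (i j) : mkX I i * mkX I j ∈ S := by
    fin_cases i <;> fin_cases j <;>
      simp [← sq, hzero_sq, mul_comm (mkX I 1), hzero_one, hone_sq]
  have hsq (i) : mkX I i * mkX I 0 ^ 2 ∈ S := by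
    have hone_zero_sq : mkX I 1 * mkX I 0 ^ 2 = 0 := by
      rw [sq, mul_left_comm, mul_comm (mkX I 1), hzero_one, mul_zero]
    fin_cases i <;> simp [← pow_succ', hcube, hone_zero_sq]
  obtain ⟨φ, hφ⟩ := exists_algEquiv_mvPolynomial_quotient hker hmul hsq he
  exact ⟨φ, hφ 0, hφ 1⟩

theorem exists_algEquiv_quotient_span_X_pow_four (he : ⇑e = frame ![a, a ^ 3]) (ha : a ^ 4 = 0) :
    ∃ φ : (K[X] ⧸ (Ideal.span {X ^ 4} : Ideal K[X])) ≃ₐ[K] R,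
      φ (Ideal.Quotient.mk _ X) = a := by
  set I : Ideal K[X] := Ideal.span {X ^ 4}
  have hker : I ≤ RingHom.ker (aeval (R := K) a) := by
    refine Ideal.span_le.mpr ?_
    rintro _ rfl
    rw [SetLike.mem_coe, RingHom.mem_ker, map_pow, aeval_X, ha]
  let φ : (K[X] ⧸ I) →ₐ[K] R := Ideal.Quotient.liftₐ I (aeval a) hker
  have hφ : φ (Ideal.Quotient.mk I X) = a := aeval_X a
  set t : K[X] ⧸ I := Ideal.Quotient.mk I X
  have hfour : t ^ 4 = 0 := Ideal.Quotient.eq_zero_iff_mem.mpr (Ideal.subset_span rfl)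
  have hadjoin : Algebra.adjoin K (Set.range ![t, t ^ 3]) = ⊤ := by
    have htop : Algebra.adjoin K {t} = ⊤ := by
      have himage : {t} = Ideal.Quotient.mkₐ K I '' {X} := Set.image_singleton.symm
      rw [himage, ← AlgHom.map_adjoin, adjoin_X, Algebra.map_top, AlgHom.range_eq_top]
      exact Ideal.Quotient.mkₐ_surjective K I
    exact top_unique (htop ▸ Algebra.adjoin_mono (Set.singleton_subset_iff.mpr ⟨0, rfl⟩))
  have hspan : Submodule.span K (Set.range (frame ![t, t ^ 3])) = ⊤ := by
    have hhigh {k : ℕ} (hk : 4 ≤ k) : t ^ k = 0 := pow_eq_zero_of_le hk hfour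
    have hsq : t ^ 2 ∈ Submodule.span K (Set.range (frame ![t, t ^ 3])) :=
      Submodule.subset_span ⟨Fin.last 3, frame_last _⟩
    have hcube : t ^ 3 ∈ Submodule.span K (Set.range (frame ![t, t ^ 3])) :=
      Submodule.subset_span ⟨(Fin.last 1).castSucc.succ, frame_succ_castSucc _ _⟩
    refine span_range_frame_eq_top hadjoin ?_ ?_
    · simp [Fin.forall_fin_two, ← pow_succ, ← pow_succ', ← pow_mul, ← sq, hhigh, hsq]
    · simp [Fin.forall_fin_two, ← pow_succ', ← pow_add, hhigh, hcube]
  have hφ_pair : ∀ i, φ (![t, t ^ 3] i) = ![a, a ^ 3] i :=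
    Fin.forall_fin_two.mpr ⟨hφ, by simp [hφ]⟩
  exact ⟨AlgEquiv.ofBijective φ (bijective_of_frame hφ_pair hspan he), hφ⟩

end Presentation

end CorankOne

theorem proposition5_general {K : Type*} [Field K] [IsAlgClosed K] [NeZero (2 : K)]
    (im : K) (him : im ^ 2 = -1)
    {R : Type*} [CommRing R] [IsLocalRing R] [Algebra K R]
    (n : ℕ) (hn : 2 ≤ n) (hR : Module.finrank K R = n + 2)
    (F : LinearMap.BilinForm K R) (hsymm : F.IsSymm)
    (hrank : Module.finrank K (LinearMap.range F) = n + 1) (hF1 : F 1 1 = 0)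
    (W : Submodule K R)
    (hWm : W ≤ (IsLocalRing.maximalIdeal R).restrictScalars K)
    (hW : Module.finrank K W + 1 = Module.finrank K (IsLocalRing.maximalIdeal R))
    (hinv : CorankOne.IsInvariant W F) :
    ∃ e : Module.Basis (Fin (n + 2)) K R,
      e 0 = 1 ∧
      W = Submodule.span K (Set.range fun i : Fin n => e i.castSucc.succ) ∧
      (IsLocalRing.maximalIdeal R).restrictScalars K
        = Submodule.span K (Set.range fun i : Fin (n + 1) => e i.succ) ∧
      e (Fin.last (n + 1)) = e 1 ^ 2 ∧
      LinearMap.BilinForm.toMatrix e F = CorankOne.normalMatrix K n ∧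
      ((3 ≤ n ∧ ∃ L : Matrix (Fin (n - 1)) (Fin (n - 1)) K, CorankOne.IsCanonical im L ∧
          ∃ φ : (MvPolynomial (Fin n) K ⧸ CorankOne.relIdeal (two_pos.trans_le hn) L) ≃ₐ[K] R,
            ∀ i : Fin n, φ (Ideal.Quotient.mk _ (MvPolynomial.X i)) = e i.castSucc.succ) ∨
        (n = 2 ∧ ∃ φ : (MvPolynomial (Fin 2) K ⧸
              (Ideal.span {MvPolynomial.X 0 ^ 3, MvPolynomial.X 0 * MvPolynomial.X 1,
                MvPolynomial.X 1 ^ 2} : Ideal (MvPolynomial (Fin 2) K))) ≃ₐ[K] R,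
            φ (Ideal.Quotient.mk _ (MvPolynomial.X 0)) = e ⟨1, Nat.one_lt_succ_succ n⟩ ∧
            φ (Ideal.Quotient.mk _ (MvPolynomial.X 1)) =
              e ⟨2, Nat.lt_add_of_pos_left (two_pos.trans_le hn)⟩) ∨
        (n = 2 ∧ ∃ φ : (Polynomial K ⧸
              (Ideal.span {Polynomial.X ^ 4} : Ideal (Polynomial K))) ≃ₐ[K] R,
            φ (Ideal.Quotient.mk _ Polynomial.X) = e ⟨1, Nat.one_lt_succ_succ n⟩ ∧
            φ (Ideal.Quotient.mk _ (Polynomial.X ^ 3)) =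
              e ⟨2, Nat.lt_add_of_pos_left (two_pos.trans_le hn)⟩ ∧
            φ (Ideal.Quotient.mk _ (Polynomial.X ^ 2)) = e ⟨3, Nat.add_le_add_right hn 2⟩)) := by
  have h : CorankOne.IsCorankOnePair n F W := ⟨hn, hR, hsymm, hrank, hF1, hWm, hW, hinv⟩
  obtain ⟨m, rfl⟩ := Nat.exists_eq_add_of_le' hn
  rcases m.eq_zero_or_pos with rfl | hm
  · obtain ⟨a, ha, ha1⟩ := h.exists_apply_one_sq
    by_cases hcube : a ^ 3 = 0
    · obtain ⟨z, hz, hz0⟩ := h.exists_mem_ker_ne_zero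
      obtain ⟨e, he, he0, heW, hem, helast, heF⟩ :=
        (h.isNormalFamily_pair ha ha1 hz hz0).exists_basis h
      obtain ⟨φ, hφ⟩ := CorankOne.exists_algEquiv_quotient_span_cube_mul_sq he hcube
        (h.mul_eq_zero_of_mem_ker (hWm ha) hz)
        (sq z ▸ h.mul_eq_zero_of_mem_ker (hWm (h.ker_le hz)) hz)
      exact ⟨e, he0, heW, hem, helast, heF, .inr (.inl ⟨rfl, φ, he ▸ hφ⟩)⟩
    · have hz := h.cube_mem_ker ha ha1
      obtain ⟨e, he, he0, heW, hem, helast, heF⟩ :=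
        (h.isNormalFamily_pair ha ha1 hz hcube).exists_basis h
      obtain ⟨φ, hφ⟩ := CorankOne.exists_algEquiv_quotient_span_X_pow_four he
        (pow_succ' a 3 ▸ h.mul_eq_zero_of_mem_ker (hWm ha) hz)
      refine ⟨e, he0, heW, hem, helast, heF, .inr (.inr ⟨rfl, φ, ?_⟩)⟩
      simp only [he, map_pow, hφ]
      exact ⟨rfl, rfl, rfl⟩
  · obtain ⟨x, L, hx, hL, hrel⟩ := h.exists_isNormalFamily_satisfiesRelations him
    obtain ⟨e, he, he0, heW, hem, helast, heF⟩ := hx.exists_basis h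
    obtain ⟨φ, hφ⟩ := hrel.exists_algEquiv hm he
    exact ⟨e, he0, heW, hem, helast, heF, .inl ⟨by omega, L, hL, φ, fun i => by
      rw [hφ, he, CorankOne.frame_succ_castSucc]⟩⟩

theorem proposition5 {K : Type*} [Field K] [IsAlgClosed K] [CharZero K]
    (im : K) (him : im ^ 2 = -1)
    {R : Type*} [CommRing R] [IsLocalRing R] [Algebra K R]
    (n : ℕ) (hn : 2 ≤ n) (hR : Module.finrank K R = n + 2)
    (F : LinearMap.BilinForm K R) (hsymm : F.IsSymm)
    (hrank : Module.finrank K (LinearMap.range F) = n + 1) (hF1 : F 1 1 = 0)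
    (W : Submodule K R)
    (hWm : W ≤ (IsLocalRing.maximalIdeal R).restrictScalars K)
    (hW : Module.finrank K W + 1 = Module.finrank K (IsLocalRing.maximalIdeal R))
    (hinv : CorankOne.IsInvariant W F) :
    ∃ e : Module.Basis (Fin (n + 2)) K R,
      e 0 = 1 ∧
      W = Submodule.span K (Set.range fun i : Fin n => e i.castSucc.succ) ∧
      (IsLocalRing.maximalIdeal R).restrictScalars K
        = Submodule.span K (Set.range fun i : Fin (n + 1) => e i.succ) ∧
      e (Fin.last (n + 1)) = e 1 ^ 2 ∧
      LinearMap.BilinForm.toMatrix e F = CorankOne.normalMatrix K n ∧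
      ((3 ≤ n ∧ ∃ L : Matrix (Fin (n - 1)) (Fin (n - 1)) K, CorankOne.IsCanonical im L ∧
          ∃ φ : (MvPolynomial (Fin n) K ⧸ CorankOne.relIdeal (by omega) L) ≃ₐ[K] R,
            ∀ i : Fin n, φ (Ideal.Quotient.mk _ (MvPolynomial.X i)) = e i.castSucc.succ) ∨
        (n = 2 ∧ ∃ φ : (MvPolynomial (Fin 2) K ⧸
              (Ideal.span {MvPolynomial.X 0 ^ 3, MvPolynomial.X 0 * MvPolynomial.X 1,
                MvPolynomial.X 1 ^ 2} : Ideal (MvPolynomial (Fin 2) K))) ≃ₐ[K] R,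
            φ (Ideal.Quotient.mk _ (MvPolynomial.X 0)) = e ⟨1, by omega⟩ ∧
            φ (Ideal.Quotient.mk _ (MvPolynomial.X 1)) = e ⟨2, by omega⟩) ∨
        (n = 2 ∧ ∃ φ : (Polynomial K ⧸
              (Ideal.span {Polynomial.X ^ 4} : Ideal (Polynomial K))) ≃ₐ[K] R,
            φ (Ideal.Quotient.mk _ Polynomial.X) = e ⟨1, by omega⟩ ∧
            φ (Ideal.Quotient.mk _ (Polynomial.X ^ 3)) = e ⟨2, by omega⟩ ∧
            φ (Ideal.Quotient.mk _ (Polynomial.X ^ 2)) = e ⟨3, by omega⟩)) :=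
  proposition5_general im him n hn hR F hsymm hrank hF1 W hWm hW hinv
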